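/- Let $\mathbb{N}_+=\{1,2,3,\dots\}$ and fix a weight $w=(w_1,w_2)\in\mathbb{N}_+^2$. For a nonzero polynomial $h=\sum c_{\alpha}x^{\alpha_1}y^{\alpha_2}\in\mathbb{C}[x,y]$ let $\deg_w h=\max\{\alpha_1w_1+\alpha_2w_2 : c_\alpha\neq 0\}$, and for a polynomial automorphism $F=(F_1,F_2)$ of $\mathbb{C}^2$ let $\mathrm{wmdeg}\,F=(\deg_w F_1,\deg_w F_2)$. Every polynomial automorphism $F$ of $\mathbb{C}^2$ can be written as $F=L_2\circ T_l\circ\cdots\circ T_1\circ L_1$ with $l\ge 0$, where $L_1,L_2$ are affine automorphisms, $T_i(x,y)=(x,y+f_i(x))$ for odd $i$, $T_i(x,y)=(x+f_i(y),y)$ for even $i$, and the $f_i$ are one-variable complex polynomials with $\deg f_i>1$; the number $l$ is uniquely determined by $F$ and is called the length of $F$. Theorem. If $F$ is a polynomial automorphism of $\mathbb{C}^2$ of length at least $2$, then $\mathrm{wmdeg}\,F$ is an element of the set \begin{align*} &\left\{(d_1,d_2)\in(w_1\mathbb{N}_+)^2 : \min\{d_1,d_2\}\ge\max\{w_1,w_2\}\text{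 and }(d_1\mid d_2\text{ or }d_2\mid d_1)\right\}\\ \cup\;&\left\{(d_1,d_2)\in(w_2\mathbb{N}_+)^2 : \min\{d_1,d_2\}\ge\max\{w_1,w_2\}\text{ and }(d_1\mid d_2\text{ or }d_2\mid d_1)\right\}. \end{align*} Moreover $|\mathrm{wmdeg}\,F|>|w|$, where $|(a,b)|=a+b$. -/

import Mathlib

/-- Polynomial mappings `ℂⁿ → ℂⁿ`, given by their coordinate polynomials. -/
abbrev PolyMap (n : ℕ) : Type := Fin n → MvPolynomial (Fin n) ℂ

namespace PolyMap

noncomputable section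

/-- The identity mapping `(x₁, …, xₙ)`. -/
def idMap (n : ℕ) : PolyMap n := fun i => MvPolynomial.X i

/-- The composition `F ∘ G`: substitute the coordinates of `G` for the variables of `F`. -/
def comp {n : ℕ} (F G : PolyMap n) : PolyMap n := fun i => MvPolynomial.bind₁ G (F i)

/-- `F` is a polynomial automorphism of `ℂⁿ`: it has a two-sided polynomial inverse. -/
def IsAut {n : ℕ} (F : PolyMap n) : Prop :=
  ∃ G : PolyMap n, comp F G = idMap n ∧ comp G F = idMap n

/-- `F` is affine: all its coordinates have degree exactly one. -/
def IsAffine {n : ℕ} (F : PolyMap n) : Prop := ∀ i, (F i).totalDegree = 1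

/-- The weighted multidegree of `F`: the tuple of the weighted degrees of its coordinates. -/
def wmdeg {n : ℕ} (w : Fin n → ℕ) (F : PolyMap n) : Fin n → ℕ :=
  fun i => MvPolynomial.weightedTotalDegree w (F i)

/-- The `i`-th triangular automorphism built from `f`:
`(x, y) ↦ (x, y + f x)` for odd `i`, and `(x, y) ↦ (x + f y, y)` for even `i`. -/
def triangular (i : ℕ) (f : Polynomial ℂ) : PolyMap 2 :=
  if Odd i then
    ![MvPolynomial.X 0, MvPolynomial.X 1 + Polynomial.aeval (MvPolynomial.X 0) f]
  else
    ![MvPolynomial.X 0 + Polynomial.aeval (MvPolynomial.X 1) f, MvPolynomial.X 1]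

/-- The composition `T_l ∘ ⋯ ∘ T_1`, where `T_i` is the `i`-th triangular automorphism
built from `f i`. -/
def triangularComp (f : ℕ → Polynomial ℂ) : ℕ → PolyMap 2
  | 0 => idMap 2
  | l + 1 => comp (triangular (l + 1) (f (l + 1))) (triangularComp f l)

/-- `F = L₂ ∘ T_l ∘ ⋯ ∘ T_1 ∘ L₁` with affine automorphisms `L₁`, `L₂` and triangular
automorphisms `T_i` of alternating type, built from polynomials of degree greater than one. -/
def HasDecomposition (F : PolyMap 2) (l : ℕ) : Prop :=
  ∃ (L₁ L₂ : PolyMap 2) (f : ℕ → Polynomial ℂ),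
    IsAut L₁ ∧ IsAffine L₁ ∧ IsAut L₂ ∧ IsAffine L₂ ∧
    (∀ i, 1 ≤ i → i ≤ l → 1 < (f i).natDegree) ∧
    F = comp L₂ (comp (triangularComp f l) L₁)

/-- The length of an automorphism `F` of `ℂ²`: the number `l` of triangular factors in a
decomposition as above. For every automorphism such an `l` exists and is unique. -/
def length (F : PolyMap 2) : ℕ := sInf {l : ℕ | HasDecomposition F l}

/-- The set `a ℕ₊` of the positive multiples of `a`. -/
def posMultiples (a : ℕ) : Set ℕ := {d | ∃ k : ℕ, 0 < k ∧ d = a * k}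

end

end PolyMap

/-! Cancellation of leading terms can matter only at the first triangular factor. For `q = L₁ 1 +
f₁(L₁ 0)`, either `L₁ 0` already has the maximal weight as its degree, so `f₁(L₁ 0)` dominates, or
`L₁ 0` lacks the heavier variable, which then survives in `q`. Hence `q` is at least as large as `L₁
0`, has degree at least both weights, and its degree is a multiple of one of them
(`weightedTotalDegree_first_step`). Each later factor replaces the smaller coordinate `p` by `p +
f(q)`, with `q` the larger one and `deg f ≥ 2`, so the new degree is exactly `deg f * deg q`. From
length two on, the degrees `e`, `d` satisfy `e ∣ d` and `2 * e ≤ d` (`DegreeChain`). As `e < d`,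
each coordinate of `L₂` yields degree `d` or `e`, and `d` occurs because `L₂` is invertible. -/

namespace MvPolynomial

/-! ### Weighted degree as a degree in one variable -/

variable {σ R : Type*} [CommRing R]

/-- The substitution `X i ↦ X i * T ^ w i`, which records the weighted degree as a degree in `T`. -/
noncomputable def weightGrading (w : σ → ℕ) :
    MvPolynomial σ R →ₐ[R] Polynomial (MvPolynomial σ R) :=
  aeval fun i => Polynomial.monomial (w i) (X i)

theorem weightGrading_monomial (w : σ → ℕ) (d : σ →₀ ℕ) (c : R) :
    weightGrading w (monomial d c) = Polynomial.monomial (Finsupp.weight w d) (monomial d c) := by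
  classical
  have key : (d.prod fun i k => (Polynomial.monomial (w i) (X i : MvPolynomial σ R)) ^ k) =
      Polynomial.monomial (Finsupp.weight w d) (monomial d (1 : R)) := by
    induction d using Finsupp.induction_linear with
    | zero => simp
    | add f g hf hg =>
      rw [Finsupp.prod_add_index' (by simp) (by intros; rw [pow_add]), hf, hg,
        Polynomial.monomial_mul_monomial, map_add, monomial_mul, one_mul]
    | single i k =>
      rw [Finsupp.prod_single_index (by simp), Polynomial.monomial_pow, X_pow_eq_monomial,
        Finsupp.weight_single, smul_eq_mul, mul_comm]
  rw [weightGrading, aeval_monomial, key, IsScalarTower.algebraMap_apply R (MvPolynomial σ R),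
    Polynomial.algebraMap_eq, Polynomial.C_mul_monomial, algebraMap_eq, C_mul_monomial, mul_one]

theorem coeff_weightGrading (w : σ → ℕ) (p : MvPolynomial σ R) (n : ℕ) :
    (weightGrading w p).coeff n = weightedHomogeneousComponent w n p := by
  classical
  induction p using MvPolynomial.monomial_add_induction_on with
  | C a =>
    ext m
    rw [← monomial_zero', weightGrading_monomial, Polynomial.coeff_monomial,
      coeff_weightedHomogeneousComponent, coeff_monomial]
    by_cases h : 0 = m
    · subst h; split_ifs <;> simp_all
    · split_ifs <;> simp_all
  | monomial_add d c p _ _ ih =>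
    rw [map_add, map_add, Polynomial.coeff_add, ih, weightGrading_monomial]
    congr 1
    ext m
    rw [Polynomial.coeff_monomial, coeff_weightedHomogeneousComponent, coeff_monomial]
    by_cases h : d = m
    · subst h; split_ifs <;> simp_all [coeff_monomial]
    · split_ifs <;> simp_all

/-- The coefficients in `T` are the weighted homogeneous components, so facts about `natDegree` over
a domain transfer to weighted degrees. -/
theorem natDegree_weightGrading (w : σ → ℕ) (p : MvPolynomial σ R) :
    (weightGrading w p).natDegree = weightedTotalDegree w p := by
  classical
  apply le_antisymm
  · rw [Polynomial.natDegree_le_iff_coeff_eq_zero]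
    intro n hn
    rw [coeff_weightGrading]
    exact weightedHomogeneousComponent_eq_zero n p hn
  · refine Finset.sup_le fun d hd => Polynomial.le_natDegree_of_ne_zero ?_
    rw [coeff_weightGrading, Ne, MvPolynomial.ext_iff, not_forall]
    refine ⟨d, ?_⟩
    rw [coeff_weightedHomogeneousComponent, if_pos rfl, coeff_zero]
    exact mem_support_iff.1 hd

theorem weightedTotalDegree_add_le (w : σ → ℕ) (p q : MvPolynomial σ R) :
    weightedTotalDegree w (p + q) ≤ max (weightedTotalDegree w p) (weightedTotalDegree w q) := by
  simpa only [← natDegree_weightGrading, map_add] using Polynomial.natDegree_add_le _ _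

theorem weightedTotalDegree_add_eq_left (w : σ → ℕ) {p q : MvPolynomial σ R}
    (h : weightedTotalDegree w q < weightedTotalDegree w p) :
    weightedTotalDegree w (p + q) = weightedTotalDegree w p := by
  simp only [← natDegree_weightGrading, map_add] at h ⊢
  exact Polynomial.natDegree_add_eq_left_of_natDegree_lt h

theorem weightedTotalDegree_add_eq_right (w : σ → ℕ) {p q : MvPolynomial σ R}
    (h : weightedTotalDegree w p < weightedTotalDegree w q) :
    weightedTotalDegree w (p + q) = weightedTotalDegree w q := by
  rw [add_comm, weightedTotalDegree_add_eq_left w h]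

theorem weightedTotalDegree_C (w : σ → ℕ) (c : R) : weightedTotalDegree w (C c) = 0 := by
  rw [← natDegree_weightGrading, ← algebraMap_eq, AlgHom.commutes,
    IsScalarTower.algebraMap_apply R (MvPolynomial σ R), Polynomial.algebraMap_eq,
    Polynomial.natDegree_C]

/-- The grading is an algebra homomorphism, so it turns `f(p)` into a composition of one-variable
polynomials, whose degrees multiply over a domain. -/
theorem weightedTotalDegree_aeval [IsDomain R] (w : σ → ℕ) (p : MvPolynomial σ R)
    (f : Polynomial R) :
    weightedTotalDegree w (Polynomial.aeval p f) = f.natDegree * weightedTotalDegree w p := by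
  have key : weightGrading w (Polynomial.aeval p f) =
      (f.map (C : R →+* MvPolynomial σ R)).comp (weightGrading w p) := by
    rw [← Polynomial.aeval_algHom_apply, Polynomial.comp, Polynomial.eval₂_map,
      Polynomial.aeval_def]
    rfl
  rw [← natDegree_weightGrading, key, Polynomial.natDegree_comp,
    Polynomial.natDegree_map_eq_of_injective (C_injective σ R), natDegree_weightGrading]

theorem weightedTotalDegree_C_mul [IsDomain R] (w : σ → ℕ) {c : R} (hc : c ≠ 0)
    (p : MvPolynomial σ R) :
    weightedTotalDegree w (C c * p) = weightedTotalDegree w p := by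
  have h := weightedTotalDegree_aeval w p (Polynomial.C c * Polynomial.X)
  rwa [map_mul, Polynomial.aeval_C, Polynomial.aeval_X, algebraMap_eq,
    Polynomial.natDegree_C_mul_X c hc, one_mul] at h

/-- A linear form in two polynomials of distinct weighted degrees has no cancellation. -/
theorem weightedTotalDegree_linear_of_lt [IsDomain R] (w : σ → ℕ) {p q : MvPolynomial σ R}
    (hpq : weightedTotalDegree w p < weightedTotalDegree w q)
    (hp : 0 < weightedTotalDegree w p) (a b c : R) :
    (b ≠ 0 → weightedTotalDegree w (C a * p + C b * q + C c) = weightedTotalDegree w q) ∧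
    (b = 0 → a ≠ 0 →
      weightedTotalDegree w (C a * p + C b * q + C c) = weightedTotalDegree w p) := by
  constructor
  · intro hb
    have h1 : weightedTotalDegree w (C a * p) ≤ weightedTotalDegree w p := by
      by_cases ha : a = 0
      · simp [ha, weightedTotalDegree_zero]
      · exact (weightedTotalDegree_C_mul w ha p).le
    have h2 : weightedTotalDegree w (C a * p + C b * q) = weightedTotalDegree w q := by
      rw [weightedTotalDegree_add_eq_right, weightedTotalDegree_C_mul w hb]
      rw [weightedTotalDegree_C_mul w hb]
      exact h1.trans_lt hpq
    rw [weightedTotalDegree_add_eq_left, h2]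
    rw [h2, weightedTotalDegree_C]
    exact hp.trans hpq
  · rintro rfl ha
    rw [C_0, zero_mul, add_zero, weightedTotalDegree_add_eq_left, weightedTotalDegree_C_mul w ha]
    rwa [weightedTotalDegree_C_mul w ha, weightedTotalDegree_C]

/-- A polynomial in two variables of total degree at most one is an affine form. -/
theorem eq_affine_of_totalDegree_le_one {p : MvPolynomial (Fin 2) R} (hp : p.totalDegree ≤ 1) :
    ∃ a b c : R, p = C a * X 0 + C b * X 1 + C c := by
  classical
  refine ⟨p.coeff (Finsupp.single 0 1), p.coeff (Finsupp.single 1 1), p.coeff 0, ?_⟩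
  ext m
  have h01 : ∀ m : Fin 2 →₀ ℕ, ∀ i j : ℕ, (m 0 = i ∧ m 1 = j) ↔
      m = Finsupp.single 0 i + Finsupp.single 1 j := by
    intro m i j
    rw [Finsupp.ext_iff, Fin.forall_fin_two]
    simp
  rw [coeff_add, coeff_add, coeff_C_mul, coeff_C_mul, coeff_X, coeff_X, coeff_C]
  by_cases hm : m 0 + m 1 ≤ 1
  · have : (m 0 = 0 ∧ m 1 = 0) ∨ (m 0 = 1 ∧ m 1 = 0) ∨ (m 0 = 0 ∧ m 1 = 1) := by omega
    simp only [h01] at this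
    rcases this with rfl | rfl | rfl <;>
      simp [Finsupp.single_eq_single_iff, eq_comm (a := (0 : Fin 2 →₀ ℕ))]
  · have h0 : p.coeff m = 0 := by
      by_contra h
      have := (le_totalDegree (mem_support_iff.2 h)).trans hp
      rw [Finsupp.sum_fintype _ _ (by simp), Fin.sum_univ_two] at this
      exact hm this
    have e0 : Finsupp.single 0 1 ≠ m := by rintro rfl; simp at hm
    have e1 : Finsupp.single 1 1 ≠ m := by rintro rfl; simp at hm
    have e2 : 0 ≠ m := by rintro rfl; simp at hm
    simp [h0, e0, e1, e2]

end MvPolynomial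

namespace PolyMap

/-! ### Affine automorphisms and triangular factors -/

open MvPolynomial

theorem comp_assoc {n : ℕ} (F G H : PolyMap n) : comp (comp F G) H = comp F (comp G H) := by
  funext i
  exact bind₁_bind₁ G H (F i)

/-- Every variable occurs in the linear part of an affine automorphism, and each coordinate of an
affine automorphism has a nonzero linear part. -/
theorem IsAffine.exists_coeff {L : PolyMap 2} (hL : IsAffine L) (hA : IsAut L) :
    ∃ a b c : Fin 2 → ℂ, (∀ k, L k = C (a k) * X 0 + C (b k) * X 1 + C (c k)) ∧
      (∀ k, a k ≠ 0 ∨ b k ≠ 0) ∧ (∃ k, a k ≠ 0) ∧ ∃ k, b k ≠ 0 := by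
  choose a b c h using fun k => eq_affine_of_totalDegree_le_one (hL k).le
  obtain ⟨G, -, hG⟩ := hA
  -- A polynomial left inverse makes `L` injective on points; a variable absent from `L` would
  -- contradict this.
  have sep : ∀ x y : Fin 2 → ℂ, (∀ k, eval x (L k) = eval y (L k)) → x = y := by
    intro x y hxy
    funext i
    have hi : bind₁ L (G i) = X i := congrFun hG i
    have e : ∀ z : Fin 2 → ℂ, eval (fun k => eval z (L k)) (G i) = z i := by
      intro z
      have := congrArg (eval z) hi
      rw [eval_X] at this
      rw [← this, ← coe_aeval_eq_eval, ← coe_aeval_eq_eval]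
      exact (aeval_bind₁ z L (G i)).symm
    rw [← e x, ← e y, funext hxy]
  refine ⟨a, b, c, h, fun k => ?_, ?_, ?_⟩
  · by_contra! hk
    have := hL k
    rw [h k, hk.1, hk.2] at this
    simp at this
  · by_contra! hk
    have := congrFun (sep ![0, 0] ![1, 0] fun k => by simp [h, hk]) 0
    simp at this
  · by_contra! hk
    have := congrFun (sep ![0, 0] ![0, 1] fun k => by simp [h, hk]) 1
    simp at this

theorem comp_triangular_of_odd {i : ℕ} (hi : Odd i) (f : Polynomial ℂ) (G : PolyMap 2) :
    comp (triangular i f) G = ![G 0, G 1 + Polynomial.aeval (G 0) f] := by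
  funext k
  fin_cases k <;> simp [comp, triangular, hi, ← Polynomial.aeval_algHom_apply]

theorem comp_triangular_of_even {i : ℕ} (hi : Even i) (f : Polynomial ℂ) (G : PolyMap 2) :
    comp (triangular i f) G = ![G 0 + Polynomial.aeval (G 1) f, G 1] := by
  have hi' : ¬ Odd i := by simpa using hi
  funext k
  fin_cases k <;> simp [comp, triangular, hi', ← Polynomial.aeval_algHom_apply]

theorem comp_triangularComp_succ (f : ℕ → Polynomial ℂ) (l : ℕ) (L : PolyMap 2) :
    comp (triangularComp f (l + 1)) L =
      comp (triangular (l + 1) (f (l + 1))) (comp (triangularComp f l) L) := by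
  rw [triangularComp, comp_assoc]

theorem comp_triangularComp_zero (f : ℕ → Polynomial ℂ) (L : PolyMap 2) :
    comp (triangularComp f 0) L = L := by
  funext i
  simp [triangularComp, comp, idMap]

/-- Adding `f(q)` to `p`, where `deg f > 1` and `q` dominates `p`, multiplies degrees. -/
theorem weightedTotalDegree_add_aeval {σ : Type*} (w : σ → ℕ) {p q : MvPolynomial σ ℂ}
    {f : Polynomial ℂ} (hf : 1 < f.natDegree) (hq : 0 < weightedTotalDegree w q)
    (hpq : weightedTotalDegree w p ≤ weightedTotalDegree w q) :
    weightedTotalDegree w (p + Polynomial.aeval q f) =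
      f.natDegree * weightedTotalDegree w q := by
  have := weightedTotalDegree_aeval w q f
  rw [weightedTotalDegree_add_eq_right, this]
  rw [this]
  nlinarith

/-- The weighted degree is at least the weight of each variable that occurs. -/
theorem le_weightedTotalDegree_of_pos {σ : Type*} [DecidableEq σ] (w : σ → ℕ) {j : σ}
    {p : MvPolynomial σ ℂ} (hp : 0 < weightedTotalDegree (Pi.single j 1) p) :
    w j ≤ weightedTotalDegree w p := by
  -- For the weight `Pi.single j 1`, the weighted degree is the degree in the variable `j`.
  obtain ⟨d, hd, h⟩ := (Finset.lt_sup_iff).1 hp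
  rw [Finsupp.weight_single_one_apply] at h
  exact (Finsupp.le_weight_of_ne_zero' w h.ne').trans (le_weightedTotalDegree w hd)

/-- The monomials are distinct, so nothing cancels even when the two weights coincide. -/
theorem weightedTotalDegree_affine (w : Fin 2 → ℕ) (a b c : ℂ) :
    weightedTotalDegree w (C a * X 0 + C b * X 1 + C c) =
      max (if a = 0 then 0 else w 0) (if b = 0 then 0 else w 1) := by
  have hX : ∀ i, weightedTotalDegree w (X i : MvPolynomial (Fin 2) ℂ) = w i := fun i => by
    rw [weightedTotalDegree, support_X, Finset.sup_singleton, Finsupp.weight_single, one_smul]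
  have hle : ∀ (a : ℂ) i, weightedTotalDegree w (C a * X i : MvPolynomial (Fin 2) ℂ) =
      if a = 0 then 0 else w i := fun a i => by
    split_ifs with h
    · simp [h, weightedTotalDegree_zero]
    · rw [weightedTotalDegree_C_mul w h, hX]
  apply le_antisymm
  · refine (weightedTotalDegree_add_le w _ _).trans (max_le ?_ ?_)
    · exact (weightedTotalDegree_add_le w _ _).trans_eq (by rw [hle, hle])
    · rw [weightedTotalDegree_C]; exact Nat.zero_le _
  · apply max_le
    · split_ifs with h
      · exact Nat.zero_le _
      · have := le_weightedTotalDegree w (φ := C a * X 0 + C b * X 1 + C c)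
          (d := Finsupp.single 0 1) (by
            simp [coeff_X, coeff_C, h, Finsupp.single_eq_single_iff,
              eq_comm (a := (0 : Fin 2 →₀ ℕ))])
        rwa [Finsupp.weight_single, one_smul] at this
    · split_ifs with h
      · exact Nat.zero_le _
      · have := le_weightedTotalDegree w (φ := C a * X 0 + C b * X 1 + C c)
          (d := Finsupp.single 1 1) (by
            simp [coeff_X, coeff_C, h, Finsupp.single_eq_single_iff,
              eq_comm (a := (0 : Fin 2 →₀ ℕ))])
        rwa [Finsupp.weight_single, one_smul] at this

/-- If the variable `j` occurs in `q` but not in `p`, then it occurs in `q + f(p)`. -/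
theorem le_weightedTotalDegree_add_aeval {σ : Type*} [DecidableEq σ] (w : σ → ℕ) {j : σ}
    {p q : MvPolynomial σ ℂ} (hp : weightedTotalDegree (Pi.single j 1) p = 0)
    (hq : 0 < weightedTotalDegree (Pi.single j 1) q) (f : Polynomial ℂ) :
    w j ≤ weightedTotalDegree w (q + Polynomial.aeval p f) := by
  apply le_weightedTotalDegree_of_pos
  rwa [weightedTotalDegree_add_eq_left]
  rwa [weightedTotalDegree_aeval, hp, mul_zero]

/-- The degrees after the first triangular factor. -/
theorem weightedTotalDegree_first_step {w : Fin 2 → ℕ} (hw : ∀ i, 0 < w i) {L : PolyMap 2}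
    (hL : IsAffine L) (hA : IsAut L) {f : Polynomial ℂ} (hf : 1 < f.natDegree) :
    let q := L 1 + Polynomial.aeval (L 0) f
    weightedTotalDegree w (L 0) ≤ weightedTotalDegree w q ∧
      max (w 0) (w 1) ≤ weightedTotalDegree w q ∧
      (w 0 ∣ weightedTotalDegree w q ∨ w 1 ∣ weightedTotalDegree w q) := by
  intro q
  obtain ⟨a, b, c, h, hne, ha, hb⟩ := hL.exists_coeff hA
  -- The weight `v` is arbitrary: both `w` and the weights `Pi.single j 1` are needed.
  have hdeg : ∀ v : Fin 2 → ℕ, ∀ k, weightedTotalDegree v (L k) =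
      max (if a k = 0 then 0 else v 0) (if b k = 0 then 0 else v 1) := fun v k => by
    rw [h, weightedTotalDegree_affine]
  have h0 := hw 0
  have h1 := hw 1
  have hpos : 0 < weightedTotalDegree w (L 0) := by
    rw [hdeg]; rcases hne 0 with h | h <;> simp [h, h0, h1]
  have hmem : weightedTotalDegree w (L 0) = w 0 ∨ weightedTotalDegree w (L 0) = w 1 := by
    have := hne 0
    rw [hdeg]; split_ifs <;> simp_all; omega
  have hmax : ∀ k, weightedTotalDegree w (L k) ≤ max (w 0) (w 1) := fun k => by
    rw [hdeg]; split_ifs <;> omega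
  rcases (hmax 0).eq_or_lt with hM | hM
  · have hq : weightedTotalDegree w q = f.natDegree * weightedTotalDegree w (L 0) :=
      weightedTotalDegree_add_aeval w hf hpos (hM ▸ hmax 1)
    have : weightedTotalDegree w (L 0) ≤ weightedTotalDegree w q := by
      rw [hq]; exact Nat.le_mul_of_pos_left _ (by omega)
    refine ⟨this, hM ▸ this, ?_⟩
    rw [hq]
    rcases hmem with e | e <;> rw [e]
    · exact Or.inl (Dvd.intro_left _ rfl)
    · exact Or.inr (Dvd.intro_left _ rfl)
  -- Here the weights differ and `L 0` omits the heavier variable. By invertibility `L 1` contains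
  -- it, and `f(L 0)` cannot cancel it.
  · have hlow : max (w 0) (w 1) ≤ weightedTotalDegree w q := by
      have hM' := hM
      rw [hdeg] at hM'
      rcases le_total (w 0) (w 1) with hle | hle
      · have hb0 : b 0 = 0 := by
          by_contra hb0
          rw [if_neg hb0] at hM'; omega
        have hb1 : b 1 ≠ 0 := by
          obtain ⟨k, hk⟩ := hb; fin_cases k <;> simp_all
        rw [max_eq_right hle]
        exact le_weightedTotalDegree_add_aeval w (by simp [hdeg, hb0]) (by simp [hdeg, hb1]) f
      · have ha0 : a 0 = 0 := by
          by_contra ha0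
          rw [if_neg ha0] at hM'; omega
        have ha1 : a 1 ≠ 0 := by
          obtain ⟨k, hk⟩ := ha; fin_cases k <;> simp_all
        rw [max_eq_left hle]
        exact le_weightedTotalDegree_add_aeval w (by simp [hdeg, ha0]) (by simp [hdeg, ha1]) f
    refine ⟨hM.le.trans hlow, hlow, ?_⟩
    have hr := weightedTotalDegree_aeval w (L 0) f
    by_cases hlt : max (w 0) (w 1) < f.natDegree * weightedTotalDegree w (L 0)
    · have hq : weightedTotalDegree w q = f.natDegree * weightedTotalDegree w (L 0) := by
        rw [← hr]
        exact weightedTotalDegree_add_eq_right w (by rw [hr]; exact (hmax 1).trans_lt hlt)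
      rw [hq]
      rcases hmem with e | e <;> rw [e]
      · exact Or.inl (Dvd.intro_left _ rfl)
      · exact Or.inr (Dvd.intro_left _ rfl)
    -- Both summands have degree at most the larger weight, so with `hlow` the degree of `q` equals
    -- that weight.
    · have hup : weightedTotalDegree w q ≤ max (w 0) (w 1) :=
        (weightedTotalDegree_add_le w _ _).trans
          (max_le (hmax 1) (by rw [hr]; exact not_lt.1 hlt))
      rw [le_antisymm hup hlow]
      rcases max_choice (w 0) (w 1) with e | e <;> rw [e]
      · exact Or.inl dvd_rfl
      · exact Or.inr dvd_rfl

/-! ### Degrees along alternating compositions -/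

/-- The degrees `d` and `e` of the dominant and of the other coordinate of an alternating
composition of at least two triangular factors. -/
structure DegreeChain (w : Fin 2 → ℕ) (d e : ℕ) : Prop where
  max_le : max (w 0) (w 1) ≤ e
  dvd : e ∣ d
  two_mul_le : 2 * e ≤ d
  weight_dvd : w 0 ∣ e ∨ w 1 ∣ e

/-- A non-strict comparison of `p` and `q` suffices because `deg f ≥ 2`. This serves both the second
factor and every later one. -/
theorem DegreeChain.of_add_aeval {w : Fin 2 → ℕ} (hw : ∀ i, 0 < w i)
    {p q : MvPolynomial (Fin 2) ℂ}
    (hpq : weightedTotalDegree w p ≤ weightedTotalDegree w q)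
    (hM : max (w 0) (w 1) ≤ weightedTotalDegree w q)
    (hd : w 0 ∣ weightedTotalDegree w q ∨ w 1 ∣ weightedTotalDegree w q)
    {f : Polynomial ℂ} (hf : 1 < f.natDegree) :
    DegreeChain w (weightedTotalDegree w (p + Polynomial.aeval q f))
      (weightedTotalDegree w q) := by
  have hpos : 0 < weightedTotalDegree w q := (hw 0).trans_le ((le_max_left _ _).trans hM)
  rw [weightedTotalDegree_add_aeval w hf hpos hpq]
  exact ⟨hM, Dvd.intro_left _ rfl, Nat.mul_le_mul_right _ hf, hd⟩

theorem DegreeChain.step {w : Fin 2 → ℕ} (hw : ∀ i, 0 < w i) {p q : MvPolynomial (Fin 2) ℂ}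
    (h : DegreeChain w (weightedTotalDegree w q) (weightedTotalDegree w p))
    {f : Polynomial ℂ} (hf : 1 < f.natDegree) :
    DegreeChain w (weightedTotalDegree w (p + Polynomial.aeval q f))
      (weightedTotalDegree w q) := by
  have hle : weightedTotalDegree w p ≤ weightedTotalDegree w q := by
    have := h.two_mul_le; omega
  exact .of_add_aeval hw hle (h.max_le.trans hle)
    (h.weight_dvd.imp (·.trans h.dvd) (·.trans h.dvd)) hf

theorem degreeChain_triangularComp {w : Fin 2 → ℕ} (hw : ∀ i, 0 < w i) {L : PolyMap 2}
    (hL : IsAffine L) (hA : IsAut L) (f : ℕ → Polynomial ℂ) {l : ℕ} (hl : 2 ≤ l)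
    (hf : ∀ i, 1 ≤ i → i ≤ l → 1 < (f i).natDegree) :
    (Even l → DegreeChain w (wmdeg w (comp (triangularComp f l) L) 0)
      (wmdeg w (comp (triangularComp f l) L) 1)) ∧
    (Odd l → DegreeChain w (wmdeg w (comp (triangularComp f l) L) 1)
      (wmdeg w (comp (triangularComp f l) L) 0)) := by
  induction l, hl using Nat.le_induction with
  | base =>
    refine ⟨fun _ => ?_, fun h => absurd h (by decide)⟩
    obtain ⟨h1, h2, h3⟩ :=
      weightedTotalDegree_first_step hw hL hA (hf 1 le_rfl one_le_two)
    rw [comp_triangularComp_succ, comp_triangular_of_even (by decide), comp_triangularComp_succ,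
      comp_triangularComp_zero, comp_triangular_of_odd (by decide)]
    exact .of_add_aeval hw h1 h2 h3 (hf 2 one_le_two le_rfl)
  | succ l hl ih =>
    obtain ⟨he, ho⟩ := ih fun i h1 h2 => hf i h1 (h2.trans l.le_succ)
    have hf' := hf (l + 1) (Nat.le_add_left 1 l) le_rfl
    rw [comp_triangularComp_succ]
    constructor
    · intro h
      rw [comp_triangular_of_even h]
      exact (ho (by rwa [Nat.even_add_one, Nat.not_even_iff_odd] at h)).step hw hf'
    · intro h
      rw [comp_triangular_of_odd h]
      exact (he (by rwa [Nat.odd_add_one, Nat.not_odd_iff_even] at h)).step hw hf'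

/-- The weighted multidegree of an invertible affine combination of the two coordinates of an
alternating composition of at least two triangular factors. -/
theorem DegreeChain.wmdeg_linear {w : Fin 2 → ℕ} (hw : ∀ i, 0 < w i)
    {p q : MvPolynomial (Fin 2) ℂ}
    (h : DegreeChain w (weightedTotalDegree w q) (weightedTotalDegree w p))
    {F : PolyMap 2} {a b c : Fin 2 → ℂ} (hF : ∀ k, F k = C (a k) * p + C (b k) * q + C (c k))
    (hne : ∀ k, a k ≠ 0 ∨ b k ≠ 0) (hb : ∃ k, b k ≠ 0) :
    wmdeg w F ∈
      {d : Fin 2 → ℕ | (∀ i, d i ∈ posMultiples (w 0)) ∧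
          max (w 0) (w 1) ≤ min (d 0) (d 1) ∧ (d 0 ∣ d 1 ∨ d 1 ∣ d 0)} ∪
      {d : Fin 2 → ℕ | (∀ i, d i ∈ posMultiples (w 1)) ∧
          max (w 0) (w 1) ≤ min (d 0) (d 1) ∧ (d 0 ∣ d 1 ∨ d 1 ∣ d 0)} ∧
    w 0 + w 1 < wmdeg w F 0 + wmdeg w F 1 := by
  obtain ⟨hM, hdvd, h2, hwd⟩ := h
  have h0 := hw 0
  have h1 := hw 1
  have hpos : 0 < weightedTotalDegree w p := by omega
  have hlin : ∀ k, (b k ≠ 0 → wmdeg w F k = weightedTotalDegree w q) ∧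
      (b k = 0 → a k ≠ 0 → wmdeg w F k = weightedTotalDegree w p) := fun k => by
    rw [wmdeg, hF]
    exact weightedTotalDegree_linear_of_lt w (by omega) hpos _ _ _
  have hor : ∀ k, wmdeg w F k = weightedTotalDegree w q ∨
      wmdeg w F k = weightedTotalDegree w p := fun k => by
    by_cases hk : b k = 0
    · exact Or.inr ((hlin k).2 hk ((hne k).resolve_right (not_not.2 hk)))
    · exact Or.inl ((hlin k).1 hk)
  have hex : wmdeg w F 0 = weightedTotalDegree w q ∨ wmdeg w F 1 = weightedTotalDegree w q := by
    obtain ⟨k, hk⟩ := hb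
    have := (hlin k).1 hk
    fin_cases k
    · exact Or.inl this
    · exact Or.inr this
  have hp : ∀ k, weightedTotalDegree w p ∣ wmdeg w F k := fun k => by
    rcases hor k with e | e <;> rw [e]
    exact hdvd
  have hge : ∀ k, weightedTotalDegree w p ≤ wmdeg w F k := fun k => by
    rcases hor k with e | e <;> omega
  have hmul : ∀ i, w i ∣ weightedTotalDegree w p → ∀ k, wmdeg w F k ∈ posMultiples (w i) := by
    intro i hi k
    obtain ⟨m, hm⟩ := hi.trans (hp k)
    refine ⟨m, Nat.pos_of_ne_zero ?_, hm⟩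
    rintro rfl
    have := hge k
    omega
  have hmin : max (w 0) (w 1) ≤ min (wmdeg w F 0) (wmdeg w F 1) :=
    le_min (hM.trans (hge 0)) (hM.trans (hge 1))
  have hdiv : wmdeg w F 0 ∣ wmdeg w F 1 ∨ wmdeg w F 1 ∣ wmdeg w F 0 := by
    rcases hor 0 with e | e
    · rcases hor 1 with e' | e' <;> rw [e, e']
      · exact Or.inl dvd_rfl
      · exact Or.inr hdvd
    · exact Or.inl (e ▸ hp 1)
  refine ⟨hwd.imp (fun h => ⟨hmul 0 h, hmin, hdiv⟩) (fun h => ⟨hmul 1 h, hmin, hdiv⟩), ?_⟩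
  have g0 := hge 0
  have g1 := hge 1
  -- One degree is `d ≥ 2 * e`, the other at least `e`, and `e` bounds both positive weights: the
  -- sum is at least `3 * e`.
  omega

end PolyMap

theorem theorem3 (w : Fin 2 → ℕ) (hw : ∀ i, 0 < w i)
    (F : PolyMap 2) (hF : PolyMap.IsAut F) (hlen : 2 ≤ PolyMap.length F) :
    PolyMap.wmdeg w F ∈
      {d : Fin 2 → ℕ | (∀ i, d i ∈ PolyMap.posMultiples (w 0)) ∧
          max (w 0) (w 1) ≤ min (d 0) (d 1) ∧ (d 0 ∣ d 1 ∨ d 1 ∣ d 0)} ∪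
      {d : Fin 2 → ℕ | (∀ i, d i ∈ PolyMap.posMultiples (w 1)) ∧
          max (w 0) (w 1) ≤ min (d 0) (d 1) ∧ (d 0 ∣ d 1 ∨ d 1 ∣ d 0)} ∧
    w 0 + w 1 < PolyMap.wmdeg w F 0 + PolyMap.wmdeg w F 1 := by
  -- `sInf ∅ = 0`, so length at least two forces a decomposition to exist.
  have hne : {l : ℕ | PolyMap.HasDecomposition F l}.Nonempty := by
    by_contra h
    rw [PolyMap.length, Set.not_nonempty_iff_eq_empty.1 h, Nat.sInf_empty] at hlen
    omega
  obtain ⟨L₁, L₂, f, hA₁, hL₁, hA₂, hL₂, hf, hdec⟩ : PolyMap.HasDecomposition F F.length :=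
    Nat.sInf_mem hne
  obtain ⟨he, ho⟩ := PolyMap.degreeChain_triangularComp hw hL₁ hA₁ f hlen hf
  obtain ⟨a, b, c, h, hab, ha, hb⟩ := hL₂.exists_coeff hA₂
  set G := PolyMap.comp (PolyMap.triangularComp f F.length) L₁
  have hFk : ∀ k, F k = MvPolynomial.C (a k) * G 0 + MvPolynomial.C (b k) * G 1 +
      MvPolynomial.C (c k) := fun k => by
    rw [hdec, PolyMap.comp, h]
    simp
  rcases Nat.even_or_odd F.length with hl | hl
  -- For even length the first coordinate dominates, so the roles of `a` and `b` are exchanged.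
  · exact (he hl).wmdeg_linear hw (fun k => by rw [hFk, add_comm (_ * G 0)])
      (fun k => (hab k).symm) ha
  · exact (ho hl).wmdeg_linear hw hFk hab hb
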